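/- Let $k$ be a quadratic number field with discriminant $d = d_1d_2d_3$, where $d_1, d_2, d_3$ are discriminants of quadratic number fields, and let all fields below be contained in a fixed extension field $\Omega$ of $k$ (for instance an algebraic closure of $k$). An $H_8$-extension of $k$ is a finite Galois extension of $k$ whose Galois group is isomorphic to the quaternion group $H_8$ of order $8$; it is called unramified if no finite prime of $k$ ramifies in it. Put $K = k(\sqrt{d_1}, \sqrt{d_2}, \sqrt{d_3}\,)$, and assume that $M = K(\sqrt{\mu}\,)$, with $\mu \in K$, and $N$ are unramified $H_8$-extensions of $k$ which both contain $K$. Then there exists a discriminant $\delta$ of a quadratic number field such that $\delta \mid d$ and $N = K(\sqrt{\delta\mu}\,)$. -/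

import Mathlib

open scoped NumberField

/-- `D` is the discriminant of some quadratic number field. -/
def IsQuadraticDiscriminant (D : ℤ) : Prop :=
  ∃ (F : Type) (_ : Field F) (_ : NumberField F),
    Module.finrank ℚ F = 2 ∧ NumberField.discr F = D

/-- The extension `L / k` is unramified at all finite primes (no condition is imposed at the
infinite places): every nonzero prime ideal of the ring of integers of `k` is unramified
in the ring of integers of `L`. -/
def IsUnramifiedExtension (k L : Type*) [Field k] [Field L] [Algebra k L] : Prop :=
  ∀ p : Ideal (𝓞 k), p.IsPrime → p ≠ ⊥ → Algebra.IsUnramifiedIn (𝓞 L) p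

/-- `L / k` is a finite Galois extension whose Galois group is the quaternion group of order 8
(in Mathlib `QuaternionGroup n` has order `4 * n`). -/
def IsH8Extension (k L : Type*) [Field k] [Field L] [Algebra k L] : Prop :=
  FiniteDimensional k L ∧ IsGalois k L ∧ Nonempty ((L ≃ₐ[k] L) ≃* QuaternionGroup 2)

/-- The field `K(r)`, for `K` between `k` and `Ω` and `r` in `Ω`, as an extension of `k`. -/
def adjoinOver {k Ω : Type*} [Field k] [Field Ω] [Algebra k Ω] (K : IntermediateField k Ω)
    (r : Ω) : IntermediateField k Ω :=
  (IntermediateField.adjoin K {r}).restrictScalars k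

/-!
Let `K ≤ M, N` with `M = K(m)` and `N = K(n)`, where `m ^ 2, n ^ 2 ∈ K`. In the quaternion group
every element outside the centre squares to the central involution, so an automorphism `γ` of the
compositum over `k` satisfies `γ (γ m) = ± m`, and the sign depends only on `γ` restricted to `K`.
For the product `m * n` the two signs cancel, so the Galois group acts on the line `K · mn` through
commuting involutions; a common eigenvector `κmn` then has its square in `k`.

Genus theory turns this square into a discriminant. Let `L / k` be unramified with `L / ℚ` Galois.
The inertia groups over `ℚ` generate the Galois group of `L / ℚ`, and their nontrivial elements are
involutions moving `k`; consequently they commute on square roots of elements of `k`. So `κmn` can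
be scaled by an element of `k` until its square is a rational `r`. Finally `ℚ(√r)` lies in `L`, and
since `L / k` is unramified the discriminant tower formula gives `discr ℚ(√r) ∣ discr k`.
-/

section Involutions

theorem exists_ne_zero_forall_smul_eq_or_smul_eq_neg {G A : Type*} [Group G] [Finite G]
    [AddCommGroup A] [DistribMulAction G A] {V : AddSubgroup A} (hV : V ≠ ⊥)
    (hsmul : ∀ (g : G), ∀ v ∈ V, g • v ∈ V ∧ g • g • v = v) :
    ∃ v ∈ V, v ≠ 0 ∧ ∀ g : G, g • v = v ∨ g • v = -v := by
  have hinv (g : G) {v : A} (hv : v ∈ V) : g⁻¹ • v = g • v :=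
    inv_smul_eq_iff.mpr (hsmul g v hv).2.symm
  have hcomm (g h : G) {v : A} (hv : v ∈ V) : g • h • v = h • g • v := by
    rw [← mul_smul, ← hinv _ hv, mul_inv_rev, mul_smul, hinv g hv, hinv h (hsmul g v hv).1]
  suffices ∀ s : Set G, s.Finite → ∃ v ∈ V, v ≠ 0 ∧ ∀ g ∈ s, g • v = v ∨ g • v = -v by
    simpa only [Set.mem_univ, true_imp_iff] using this Set.univ Set.finite_univ
  intro s hs
  induction s, hs using Set.Finite.induction_on with
  | empty =>
    obtain ⟨v, hv, hv0⟩ := V.bot_or_exists_ne_zero.resolve_left hV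
    exact ⟨v, hv, hv0, by simp⟩
  | @insert g s _ _ ih =>
    obtain ⟨v, hv, hv0, hs⟩ := ih
    by_cases h : v + g • v = 0
    · exact ⟨v, hv, hv0, Set.forall_mem_insert.mpr ⟨.inr (eq_neg_of_add_eq_zero_right h), hs⟩⟩
    · refine ⟨v + g • v, add_mem hv (hsmul g v hv).1, h,
        Set.forall_mem_insert.mpr ⟨.inl ?_, fun i hi => ?_⟩⟩
      · rw [smul_add, (hsmul g v hv).2, add_comm]
      · rw [smul_add, hcomm i g hv]
        rcases hs i hi with hi | hi <;> rw [hi]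
        · exact .inl rfl
        · exact .inr (by rw [smul_neg, neg_add])

theorem exists_smul_sq_mem_range_algebraMap {F E L : Type*} [Field F] [Field E] [Field L]
    [Algebra F L] [Algebra E L] [FiniteDimensional F L] [IsGalois F L] {u : L} (hu : u ≠ 0)
    (hmap : ∀ (σ : Gal(L/F)) (κ : E), (∃ κ' : E, κ' • u = σ (κ • u)) ∧ σ (σ (κ • u)) = κ • u) :
    ∃ κ : E, κ ≠ 0 ∧ (κ • u) ^ 2 ∈ Set.range (algebraMap F L) := by
  let V : AddSubgroup L := (Submodule.span E {u}).toAddSubgroup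
  have mem_V {v : L} : v ∈ V ↔ ∃ κ : E, κ • u = v := Submodule.mem_span_singleton
  have hV : V ≠ ⊥ :=
    V.ne_bot_iff_exists_ne_zero.mpr ⟨⟨u, mem_V.mpr ⟨1, one_smul _ _⟩⟩, Subtype.coe_ne_coe.mp hu⟩
  have hVmap (σ : Gal(L/F)) : ∀ v ∈ V, σ • v ∈ V ∧ σ • σ • v = v := by
    simp only [mem_V]
    rintro _ ⟨κ, rfl⟩
    exact hmap σ κ
  obtain ⟨v, hv, hv0, hσv⟩ := exists_ne_zero_forall_smul_eq_or_smul_eq_neg hV hVmap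
  obtain ⟨κ, rfl⟩ := mem_V.mp hv
  refine ⟨κ, left_ne_zero_of_smul hv0, (IsGalois.mem_range_algebraMap_iff_fixed _).mpr fun σ => ?_⟩
  rw [map_pow, sq_eq_sq_iff_eq_or_eq_neg]
  exact hσv σ

end Involutions

section Quadratic

variable {K L : Type*} [Field K] [Field L] [Algebra K L]

theorem finrank_adjoin_simple_eq_two {θ : L} (hθ : θ ∉ Set.range (algebraMap K L)) {r : K}
    (hr : θ ^ 2 = algebraMap K L r) : Module.finrank K (IntermediateField.adjoin K {θ}) = 2 := by
  have hint : IsIntegral K θ := .of_pow two_pos (hr ▸ isIntegral_algebraMap)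
  rw [IntermediateField.adjoin.finrank hint]
  refine le_antisymm ?_ ((minpoly.two_le_natDegree_iff hint).mpr hθ)
  rw [← Polynomial.natDegree_X_pow_sub_C (n := 2) (r := r)]
  refine Polynomial.natDegree_le_of_dvd (minpoly.dvd K θ ?_)
    (Polynomial.monic_X_pow_sub_C r two_ne_zero).ne_zero
  rw [map_sub, map_pow, Polynomial.aeval_X, Polynomial.aeval_C, hr, sub_self]

variable [CharZero K]

theorem exists_sq_mem_range_adjoin_eq_top (h : Module.finrank K L = 2) :
    ∃ α : L, α ∉ Set.range (algebraMap K L) ∧ α ^ 2 ∈ Set.range (algebraMap K L) ∧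
      IntermediateField.adjoin K {α} = ⊤ := by
  have : Algebra.IsQuadraticExtension K L := ⟨h⟩
  have hroots : (primitiveRoots (Module.finrank K L) K).Nonempty := by
    rw [h]
    exact ⟨-1, (mem_primitiveRoots two_pos).mpr (IsPrimitiveRoot.neg_one 0 two_ne_zero.symm)⟩
  obtain ⟨α, hsq, hα⟩ := exists_root_adjoin_eq_top_of_isCyclic K L hroots
  refine ⟨α, fun hK => ?_, h ▸ hsq, hα⟩
  rw [← IntermediateField.mem_bot, ← IntermediateField.finrank_adjoin_simple_eq_one_iff, hα,
    IntermediateField.finrank_top', h] at hK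
  exact absurd hK (by norm_num)

theorem trace_eq_zero_of_sq_eq [FiniteDimensional K L] [IsGalois K L] {θ : L}
    (hθ : θ ∉ Set.range (algebraMap K L)) (hsq : θ ^ 2 ∈ Set.range (algebraMap K L)) :
    Algebra.trace K L θ = 0 := by
  rw [IsGalois.mem_range_algebraMap_iff_fixed] at hθ hsq
  push Not at hθ
  obtain ⟨σ, hσ⟩ := hθ
  have hneg : σ θ = -θ :=
    (sq_eq_sq_iff_eq_or_eq_neg.mp ((map_pow σ θ 2).symm.trans (hsq σ))).resolve_left hσ
  have h := Algebra.trace_eq_of_algEquiv σ θ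
  rwa [hneg, map_neg, neg_eq_self] at h

theorem discr_one_of_sq_eq (h : Module.finrank K L = 2) {θ : L}
    (hθ : θ ∉ Set.range (algebraMap K L)) {r : K} (hr : θ ^ 2 = algebraMap K L r) :
    Algebra.discr K ![1, θ] = 4 * r := by
  have : Algebra.IsQuadraticExtension K L := ⟨h⟩
  have htrace := trace_eq_zero_of_sq_eq hθ ⟨r, hr.symm⟩
  have h1 : Algebra.trace K L 1 = 2 := by
    rw [← map_one (algebraMap K L), Algebra.trace_algebraMap, h, nsmul_one, Nat.cast_ofNat]
  have h2 : Algebra.trace K L (θ * θ) = 2 * r := by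
    rw [← pow_two, hr, Algebra.trace_algebraMap, h, nsmul_eq_mul, Nat.cast_ofNat]
  simp only [Algebra.discr_def, Matrix.det_fin_two, Algebra.traceMatrix_apply,
    Algebra.traceForm_apply, Matrix.cons_val_zero, Matrix.cons_val_one, one_mul, mul_one, htrace,
    h1, h2]
  ring

end Quadratic

section NormalSubextension

variable {F k L : Type*} [Field F] [Field k] [Field L] [Algebra F k] [Algebra k L] [Algebra F L]
  [IsScalarTower F k L]

theorem algEquiv_apply_mem_range_algebraMap [Normal F k] (τ : Gal(L/F)) {x : L}
    (hx : x ∈ Set.range (algebraMap k L)) : τ x ∈ Set.range (algebraMap k L) := by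
  obtain ⟨a, rfl⟩ := hx
  exact ⟨_, τ.restrictNormal_commutes k a⟩

theorem algEquiv_apply_eq_or_of_finrank_eq_two [IsGalois F k]
    (hk : Module.finrank F k = 2) (σ τ : Gal(L/F)) :
    (∀ a : k, σ (algebraMap k L a) = algebraMap k L a) ∨
    (∀ a : k, τ (algebraMap k L a) = algebraMap k L a) ∨
      ∀ a : k, σ (τ (algebraMap k L a)) = algebraMap k L a := by
  have : Algebra.IsQuadraticExtension F k := ⟨hk⟩
  have hcard : Nat.card Gal(k/F) = 2 := (IsGalois.card_aut_eq_finrank F k).trans hk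
  obtain ⟨z, -, huniq⟩ := (Nat.card_eq_two_iff' (1 : Gal(k/F))).mp hcard
  have coe (σ : Gal(L/F)) (a : k) :
      algebraMap k L (σ.restrictNormal k a) = σ (algebraMap k L a) := σ.restrictNormal_commutes k a
  have hzz : z * z = 1 := by
    have h := pow_card_eq_one' (x := z)
    rwa [hcard, pow_two] at h
  by_cases hσ : σ.restrictNormal k = 1
  · exact .inl fun a => by rw [← coe, hσ, AlgEquiv.one_apply]
  by_cases hτ : τ.restrictNormal k = 1
  · exact .inr (.inl fun a => by rw [← coe, hτ, AlgEquiv.one_apply])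
  · refine .inr (.inr fun a => ?_)
    rw [← coe, ← coe, huniq _ hσ, huniq _ hτ, ← AlgEquiv.mul_apply, hzz, AlgEquiv.one_apply]

end NormalSubextension

section Quaternion

theorem algEquiv_apply_mem_of_normal {k L : Type*} [Field k] [Field L] [Algebra k L]
    {M : IntermediateField k L} [Normal k M] (γ : Gal(L/k)) {x : L} (hx : x ∈ M) : γ x ∈ M := by
  obtain ⟨y, hy⟩ := algEquiv_apply_mem_range_algebraMap γ ⟨(⟨x, hx⟩ : M), rfl⟩
  exact hy ▸ y.2

theorem quaternionGroup_two_eq_one_or_eq_or_mul_self_eq {z σ : QuaternionGroup 2} :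
    z ≠ 1 → z * z = 1 → σ = 1 ∨ σ = z ∨ σ * σ = z := by
  revert z σ
  decide

variable {k M : Type*} [Field k] [Field M] [Algebra k M]

namespace IsH8Extension

theorem of_algEquiv {M' : Type*} [Field M'] [Algebra k M'] (hM : IsH8Extension k M)
    (f : M ≃ₐ[k] M') : IsH8Extension k M' := by
  obtain ⟨_, _, ⟨e⟩⟩ := hM
  exact ⟨Module.Finite.equiv f.toLinearEquiv, .of_algEquiv f, ⟨(AlgEquiv.autCongr f).symm.trans e⟩⟩

theorem finrank_eq (hM : IsH8Extension k M) : Module.finrank k M = 8 := by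
  obtain ⟨_, _, ⟨e⟩⟩ := hM
  rw [← IsGalois.card_aut_eq_finrank, Nat.card_congr e.toEquiv, Nat.card_eq_fintype_card,
    QuaternionGroup.card]

theorem eq_one_or_eq_or_mul_self_eq (hM : IsH8Extension k M) {z : Gal(M/k)}
    (hz : z ≠ 1) (hzz : z * z = 1) (σ : Gal(M/k)) : σ = 1 ∨ σ = z ∨ σ * σ = z := by
  obtain ⟨-, -, ⟨e⟩⟩ := hM
  have h := quaternionGroup_two_eq_one_or_eq_or_mul_self_eq (z := e z) (σ := e σ)
  simp only [← map_mul, Ne, map_eq_one_iff e e.injective, EmbeddingLike.apply_eq_iff_eq] at h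
  exact h hz hzz

theorem exists_central_involution (hM : IsH8Extension k M)
    {K : IntermediateField k M} (hK : Module.finrank k K = 4) :
    ∃ z : Gal(M/k), (∀ x, z x = x ↔ x ∈ K) ∧ ∀ σ, σ = 1 ∨ σ = z ∨ σ * σ = z := by
  have := hM.1
  have := hM.2.1
  have hcard : Nat.card K.fixingSubgroup = 2 := by
    have := Module.finrank_mul_finrank k K M
    rw [IsGalois.card_fixingSubgroup_eq_finrank]
    rw [hK, hM.finrank_eq] at this
    omega
  obtain ⟨⟨z, hzK⟩, hz1, hz⟩ := (Nat.card_eq_two_iff' (1 : K.fixingSubgroup)).mp hcard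
  have hzz : z * z = 1 := by
    have h := pow_card_eq_one' (G := K.fixingSubgroup) (x := ⟨z, hzK⟩)
    rw [hcard, pow_two] at h
    exact congrArg Subtype.val h
  refine ⟨z, fun x => ⟨fun hx => ?_, fun hx => hzK ⟨x, hx⟩⟩,
    hM.eq_one_or_eq_or_mul_self_eq (fun h => hz1 (Subtype.ext h)) hzz⟩
  rw [← IsGalois.fixedField_fixingSubgroup K]
  intro τ
  by_cases hτ : τ = 1
  · rw [hτ, one_smul]
  · rw [hz τ hτ]; exact hx

variable {L : Type*} [Field L] [Algebra k L] [Normal k L] {K M : IntermediateField k L}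

theorem exists_involution_forall_algEquiv (hM : IsH8Extension k M) (hKM : K ≤ M)
    (hK : Module.finrank k K = 4) :
    ∃ z : Gal(L/k), (∀ x ∈ M, z x = x ↔ x ∈ K) ∧
      ∀ γ : Gal(L/k), (∀ x ∈ M, γ x = x) ∨ (∀ x ∈ M, γ x = z x) ∨ ∀ x ∈ M, γ (γ x) = z x := by
  have := hM.2.1
  have hK' : Module.finrank k (IntermediateField.restrict hKM) = 4 := by
    rw [← hK, (IntermediateField.restrictAlgEquiv hKM).toLinearEquiv.finrank_eq]
  obtain ⟨z, hz, hσz⟩ := hM.exists_central_involution hK'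
  have coe_z (x : M) : z.liftNormal L x = (z x : L) := z.liftNormal_commutes L x
  refine ⟨z.liftNormal L, fun x hx => ?_, fun γ => ?_⟩
  · rw [coe_z ⟨x, hx⟩, ← IntermediateField.mem_restrict hKM ⟨x, hx⟩, ← hz, Subtype.ext_iff]
  · have coe_γ (x : M) : γ x = (γ.restrictNormal M x : L) := (γ.restrictNormal_commutes M x).symm
    refine (hσz (γ.restrictNormal M)).imp (fun h x hx => ?_)
      (Or.imp (fun h x hx => ?_) fun h x hx => ?_)
    · rw [coe_γ ⟨x, hx⟩, h, AlgEquiv.one_apply]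
    · rw [coe_γ ⟨x, hx⟩, coe_z ⟨x, hx⟩, h]
    · rw [coe_γ ⟨x, hx⟩, coe_γ, coe_z ⟨x, hx⟩, ← h, AlgEquiv.mul_apply]

theorem apply_mem_and_apply_apply_eq (hM : IsH8Extension k M) (hKM : K ≤ M)
    (hK : Module.finrank k K = 4) (γ : Gal(L/k)) {x : L} (hx : x ∈ K) :
    γ x ∈ K ∧ γ (γ x) = x := by
  have := hM.2.1
  obtain ⟨z, hz, hγz⟩ := hM.exists_involution_forall_algEquiv hKM hK
  have hxM := hKM hx
  have hγx : γ x ∈ M := algEquiv_apply_mem_of_normal γ hxM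
  rw [← hz _ hγx]
  rw [← hz _ hxM] at hx
  rcases hγz γ with h | h | h
  · rw [h x hxM, hx, h x hxM]
    exact ⟨rfl, rfl⟩
  · rw [h x hxM, hx, hx, h x hxM, hx]
    exact ⟨rfl, rfl⟩
  · rw [← h _ hγx, h x hxM, hx]
    exact ⟨rfl, rfl⟩

theorem apply_div_mem_and_apply_apply_eq (hM : IsH8Extension k M) (hKM : K ≤ M)
    (hK : Module.finrank k K = 4) {m : L} (hmM : m ∈ M) (hmK : m ∉ K) (hm : m ^ 2 ∈ K)
    (γ : Gal(L/k)) :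
    γ m / m ∈ K ∧ ((∀ x ∈ K, γ x = x) ∧ γ (γ m) = m ∨ (∃ x ∈ K, γ x ≠ x) ∧ γ (γ m) = -m) := by
  have := hM.2.1
  obtain ⟨z, hz, hγz⟩ := hM.exists_involution_forall_algEquiv hKM hK
  have hγm : γ m ∈ M := algEquiv_apply_mem_of_normal γ hmM
  have apply_eq_or {τ : Gal(L/k)} (hτ : ∀ x ∈ K, τ x = x) : τ m = m ∨ τ m = -m := by
    rw [← sq_eq_sq_iff_eq_or_eq_neg, ← map_pow, hτ _ hm]
  have hzK : ∀ x ∈ K, z x = x := fun x hx => (hz x (hKM hx)).mpr hx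
  have hzm : z m = -m := (apply_eq_or hzK).resolve_left (mt (hz m hmM).mp hmK)
  have hcomm : z (γ m) = γ (z m) := by
    rcases hγz γ with h | h | h
    · rw [hzm, map_neg, h m hmM, hzm]
    · rw [h m hmM, hzm, map_neg, map_neg, h m hmM]
    · rw [← h m hmM, h _ hγm]
  refine ⟨?_, ?_⟩
  · rw [← hz _ (div_mem hγm hmM), map_div₀, hcomm, hzm, map_neg, neg_div_neg_eq]
  by_cases hγK : ∀ x ∈ K, γ x = x
  · refine .inl ⟨hγK, ?_⟩
    rcases apply_eq_or hγK with h | h <;> simp only [h, map_neg, neg_neg]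
  · refine .inr ⟨by push Not at hγK; exact hγK, ?_⟩
    rcases hγz γ with h | h | h
    · exact absurd (fun x hx => h x (hKM hx)) hγK
    · exact absurd (fun x hx => (h x (hKM hx)).trans (hzK x hx)) hγK
    · rw [h m hmM, hzm]

end IsH8Extension

theorem exists_sq_mem_range_of_isH8Extension_of_isGalois {k L : Type*} [Field k] [Field L]
    [Algebra k L] [FiniteDimensional k L] [IsGalois k L] {K M N : IntermediateField k L}
    (hM : IsH8Extension k M) (hN : IsH8Extension k N) (hKM : K ≤ M) (hKN : K ≤ N)
    (hK : Module.finrank k K = 4) {m n : L} (hmM : m ∈ M) (hmK : m ∉ K) (hm : m ^ 2 ∈ K)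
    (hnN : n ∈ N) (hnK : n ∉ K) (hn : n ^ 2 ∈ K) :
    ∃ κ : K, κ ≠ 0 ∧ (κ * (m * n)) ^ 2 ∈ Set.range (algebraMap k L) := by
  have hm0 : m ≠ 0 := fun h => hmK (h ▸ K.zero_mem)
  have hn0 : n ≠ 0 := fun h => hnK (h ▸ K.zero_mem)
  refine exists_smul_sq_mem_range_algebraMap (E := K) (mul_ne_zero hm0 hn0) fun γ κ => ?_
  simp only [IntermediateField.smul_def, smul_eq_mul]
  obtain ⟨hγκ, hγγκ⟩ := hM.apply_mem_and_apply_apply_eq hKM hK γ κ.2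
  obtain ⟨hγm, hγγm⟩ := hM.apply_div_mem_and_apply_apply_eq hKM hK hmM hmK hm γ
  obtain ⟨hγn, hγγn⟩ := hN.apply_div_mem_and_apply_apply_eq hKN hK hnN hnK hn γ
  refine ⟨⟨⟨γ κ * (γ m / m) * (γ n / n), mul_mem (mul_mem hγκ hγm) hγn⟩, ?_⟩, ?_⟩
  · simp only [map_mul]
    field_simp
  · simp only [map_mul, hγγκ]
    rcases hγγm with ⟨hγK, hγγm⟩ | ⟨⟨x, hx, hγx⟩, hγγm⟩ <;>
      rcases hγγn with ⟨hγK', hγγn⟩ | ⟨⟨y, hy, hγy⟩, hγγn⟩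
    · rw [hγγm, hγγn]
    · exact absurd (hγK y hy) hγy
    · exact absurd (hγK' x hx) hγx
    · rw [hγγm, hγγn, neg_mul_neg]

theorem exists_sq_mem_range_of_isH8Extension {k Ω : Type*} [Field k] [Field Ω] [Algebra k Ω]
    {K M N : IntermediateField k Ω} (hM : IsH8Extension k M) (hN : IsH8Extension k N)
    (hKM : K ≤ M) (hKN : K ≤ N) (hK : Module.finrank k K = 4) {m n : Ω}
    (hmM : m ∈ M) (hmK : m ∉ K) (hm : m ^ 2 ∈ K) (hnN : n ∈ N) (hnK : n ∉ K) (hn : n ^ 2 ∈ K) :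
    ∃ κ : K, κ ≠ 0 ∧ (κ * (m * n)) ^ 2 ∈ Set.range (algebraMap k Ω) := by
  have := hM.1
  have := hM.2.1
  have := hN.1
  have := hN.2.1
  let E := M ⊔ N
  have hME : M ≤ E := le_sup_left
  have hNE : N ≤ E := le_sup_right
  have hKE : K ≤ E := hKM.trans hME
  have mem_restrict_iff {F : IntermediateField k Ω} (hF : F ≤ E) (x : E) :
      x ∈ IntermediateField.restrict hF ↔ (x : Ω) ∈ F := IntermediateField.mem_restrict hF x
  have hK' : Module.finrank k (IntermediateField.restrict hKE) = 4 := by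
    rw [← hK, (IntermediateField.restrictAlgEquiv hKE).toLinearEquiv.finrank_eq]
  obtain ⟨⟨κ, hκ⟩, hκ0, a, ha⟩ := exists_sq_mem_range_of_isH8Extension_of_isGalois
    (K := IntermediateField.restrict hKE) (m := ⟨m, hME hmM⟩) (n := ⟨n, hNE hnN⟩)
    (hM.of_algEquiv (IntermediateField.restrictAlgEquiv hME))
    (hN.of_algEquiv (IntermediateField.restrictAlgEquiv hNE))
    (fun x hx => by rw [mem_restrict_iff] at hx ⊢; exact hKM hx)
    (fun x hx => by rw [mem_restrict_iff] at hx ⊢; exact hKN hx) hK'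
    ((mem_restrict_iff _ _).mpr hmM) (mt (mem_restrict_iff _ _).mp hmK)
    ((mem_restrict_iff _ _).mpr hm) ((mem_restrict_iff _ _).mpr hnN)
    (mt (mem_restrict_iff _ _).mp hnK) ((mem_restrict_iff _ _).mpr hn)
  refine ⟨⟨κ, (mem_restrict_iff _ _).mp hκ⟩, fun h => hκ0 ?_, a, congrArg Subtype.val ha⟩
  exact Subtype.ext (Subtype.ext (show (κ : Ω) = 0 from congrArg Subtype.val h))

end Quaternion

section QuadraticNumberField

variable {F : Type*} [Field F] [NumberField F]

theorem isQuadraticDiscriminant_discr (hF : Module.finrank ℚ F = 2) :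
    IsQuadraticDiscriminant (NumberField.discr F) := by
  let f : F →ₐ[ℚ] ℂ := IsAlgClosed.lift
  let e : F ≃ₐ[ℚ] f.fieldRange := AlgEquiv.ofInjectiveField f
  have : FiniteDimensional ℚ f.fieldRange := Module.Finite.equiv e.toLinearEquiv
  have : NumberField f.fieldRange := { }
  exact ⟨f.fieldRange, inferInstance, inferInstance, e.toLinearEquiv.finrank_eq ▸ hF,
    (NumberField.discr_eq_discr_of_algEquiv F e).symm⟩

theorem exists_discr_eq_mul_sq (hF : Module.finrank ℚ F = 2) {θ : F}
    (hθ : θ ∉ Set.range (algebraMap ℚ F)) {r : ℚ} (hr : θ ^ 2 = algebraMap ℚ F r) :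
    ∃ q : ℚ, (NumberField.discr F : ℚ) = r * q ^ 2 := by
  have hr0 : r ≠ 0 := by
    rintro rfl
    exact hθ ⟨0, by simp_all⟩
  have hcard : Fintype.card (Module.Free.ChooseBasisIndex ℤ (𝓞 F)) = Fintype.card (Fin 2) := by
    rw [← Module.finrank_eq_card_basis (NumberField.integralBasis F), hF, Fintype.card_fin]
  let b := (NumberField.integralBasis F).reindex (Fintype.equivOfCardEq hcard)
  let P := b.toMatrix ![1, θ]
  have hP : 4 * r = P.det ^ 2 * NumberField.discr F := by
    rw [← discr_one_of_sq_eq hF hθ hr, ← b.toMatrix_map_vecMul ![1, θ],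
      Algebra.discr_of_matrix_vecMul, NumberField.coe_discr, Module.Basis.coe_reindex,
      Algebra.discr_reindex]
  have hdet : P.det ≠ 0 := by
    intro h
    simp [h, hr0] at hP
  refine ⟨2 / P.det, ?_⟩
  field_simp
  linear_combination -hP

theorem exists_sq_eq_discr (hF : Module.finrank ℚ F = 2) :
    ∃ s : F, s ^ 2 = (NumberField.discr F : F) := by
  obtain ⟨θ, hθ, ⟨r, hr⟩, -⟩ := exists_sq_mem_range_adjoin_eq_top hF
  obtain ⟨q, hq⟩ := exists_discr_eq_mul_sq hF hθ hr.symm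
  refine ⟨algebraMap ℚ F q * θ, ?_⟩
  rw [← Rat.cast_intCast (α := F), hq, mul_pow, ← hr]
  simp [mul_comm]

end QuadraticNumberField

section Unramified

variable {k L : Type*} [Field k] [NumberField k] [Field L] [NumberField L]

theorem perfectField_residueField {R : Type*} [CommRing R] [Ring.HasFiniteQuotients R]
    {p : Ideal R} [p.IsPrime] (hp : p ≠ ⊥) : PerfectField p.ResidueField := by
  have := Ideal.IsPrime.isMaximal ‹_› hp
  have := Ring.HasFiniteQuotients.finiteQuotient hp
  infer_instance

namespace IsUnramifiedExtension

section

variable [Algebra k L]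

theorem differentIdeal_eq_top (hL : IsUnramifiedExtension k L) :
    differentIdeal (𝓞 k) (𝓞 L) = ⊤ := by
  by_contra h
  obtain ⟨P, hPmax, hP⟩ := Ideal.exists_le_maximal _ h
  have hPbot : P ≠ ⊥ := Ring.ne_bot_of_isMaximal_of_not_isField hPmax
    (NumberField.RingOfIntegers.not_isField L)
  have hp : P.under (𝓞 k) ≠ ⊥ := Ideal.IsIntegral.comap_ne_bot (𝓞 k) hPbot
  exact dvd_differentIdeal_iff.mp (Ideal.dvd_iff_le.mpr hP)
    (hL _ inferInstance hp P inferInstance ⟨rfl⟩)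

theorem natAbs_discr_eq (hL : IsUnramifiedExtension k L) :
    (NumberField.discr L).natAbs = (NumberField.discr k).natAbs ^ Module.finrank k L := by
  rw [NumberField.natAbs_discr_eq_absNorm_differentIdeal_mul_natAbs_discr_pow k (𝓞 k) L (𝓞 L),
    hL.differentIdeal_eq_top, Ideal.absNorm_top, one_mul]

theorem discr_dvd_discr (hL : IsUnramifiedExtension k L) {F : Type*} [Field F] [NumberField F]
    [Algebra F L] (h : Module.finrank ℚ F = Module.finrank ℚ k) :
    NumberField.discr F ∣ NumberField.discr k := by
  have hrank : Module.finrank F L = Module.finrank k L := by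
    have hF := Module.finrank_mul_finrank ℚ F L
    rw [← Module.finrank_mul_finrank ℚ k L, h] at hF
    exact Nat.eq_of_mul_eq_mul_left Module.finrank_pos hF
  have hdvd :=
    NumberField.natAbs_discr_eq_absNorm_differentIdeal_mul_natAbs_discr_pow F (𝓞 F) L (𝓞 L)
  rw [hL.natAbs_discr_eq, hrank] at hdvd
  exact Int.natAbs_dvd_natAbs.mp
    ((Nat.pow_dvd_pow_iff Module.finrank_pos.ne').mp (Dvd.intro_left _ hdvd.symm))

theorem inertia_eq_bot [IsGalois k L] (hL : IsUnramifiedExtension k L) (P : Ideal (𝓞 L))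
    [P.IsMaximal] : P.inertia Gal(L/k) = ⊥ := by
  have hPbot : P ≠ ⊥ := Ring.ne_bot_of_isMaximal_of_not_isField ‹_›
    (NumberField.RingOfIntegers.not_isField L)
  have hp : P.under (𝓞 k) ≠ ⊥ := Ideal.IsIntegral.comap_ne_bot (𝓞 k) hPbot
  have := perfectField_residueField hp
  have hram := (hL _ inferInstance hp).ramificationIdx_eq_one (𝔓 := P) ⟨rfl⟩
  have hcard := Ideal.card_inertia_eq_ramificationIdxIn (G := Gal(L/k)) (P.under (𝓞 k)) P
  rw [Ideal.ramificationIdxIn_eq_ramificationIdx _ P Gal(L/k), hram] at hcard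
  exact Subgroup.eq_bot_of_card_eq _ hcard

theorem of_inertia_eq_bot [IsGalois k L]
    (h : ∀ P : Ideal (𝓞 L), P.IsMaximal → P.inertia Gal(L/k) = ⊥) :
    IsUnramifiedExtension k L := by
  intro p _ hp P _ _
  have hPbot := Ideal.ne_bot_of_liesOver_of_ne_bot hp P
  have := perfectField_residueField hp
  have hcard := Ideal.card_inertia_eq_ramificationIdxIn (G := Gal(L/k)) p P
  rw [h P (Ideal.IsPrime.isMaximal ‹_› hPbot), Subgroup.card_bot,
    Ideal.ramificationIdxIn_eq_ramificationIdx _ P Gal(L/k), eq_comm,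
    Ideal.ramificationIdx_eq_one_iff] at hcard
  exact hcard

end

theorem apply_eq_of_mem_inertia {E : Type*} [Field E] [NumberField E] [Algebra k E] [IsGalois k E]
    (hE : IsUnramifiedExtension k E) (f : E →+* L) {P : Ideal (𝓞 L)} [P.IsMaximal]
    {j : Gal(L/ℚ)} (hj : j ∈ P.inertia Gal(L/ℚ))
    (hjk : ∀ a : k, j (f (algebraMap k E a)) = f (algebraMap k E a)) (y : E) : j (f y) = f y := by
  let _ : Algebra E L := f.toAlgebra
  let _ : Algebra k L := (f.comp (algebraMap k E)).toAlgebra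
  have : IsScalarTower k E L := .of_algebraMap_eq fun _ => rfl
  let j' : Gal(L/k) := AlgEquiv.ofRingEquiv (f := (j : L ≃+* L)) hjk
  let σ : Gal(E/k) := j'.restrictNormal E
  have hσ (x : E) : f (σ x) = j (f x) := j'.restrictNormal_commutes E x
  have hσ_mem : σ ∈ (P.under (𝓞 E)).inertia Gal(E/k) := by
    intro x
    have hx : j • algebraMap (𝓞 E) (𝓞 L) x - algebraMap (𝓞 E) (𝓞 L) x ∈ P := hj _
    change algebraMap (𝓞 E) (𝓞 L) (σ • x - x) ∈ P
    convert! hx using 1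
    rw [map_sub]
    exact congrArg (· - _) (NumberField.RingOfIntegers.ext (hσ x))
  rw [hE.inertia_eq_bot, Subgroup.mem_bot] at hσ_mem
  rw [← hσ, hσ_mem, AlgEquiv.one_apply]

theorem eq_one_of_mem_inertia [Algebra k L] [IsGalois k L]
    (hL : IsUnramifiedExtension k L) {P : Ideal (𝓞 L)} [P.IsMaximal] {j : Gal(L/ℚ)}
    (hj : j ∈ P.inertia Gal(L/ℚ))
    (hjk : ∀ a : k, j (algebraMap k L a) = algebraMap k L a) : j = 1 :=
  AlgEquiv.ext (hL.apply_eq_of_mem_inertia (RingHom.id L) hj hjk)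

theorem sup {Ω : Type*} [Field Ω] [Algebra k Ω] {M N : IntermediateField k Ω}
    [FiniteDimensional k M] [FiniteDimensional k N] [IsGalois k M] [IsGalois k N]
    (hM : IsUnramifiedExtension k M) (hN : IsUnramifiedExtension k N) :
    IsUnramifiedExtension k (M ⊔ N : IntermediateField k Ω) := by
  have : CharZero Ω := charZero_of_injective_algebraMap (algebraMap k Ω).injective
  have numberField (F : IntermediateField k Ω) [FiniteDimensional k F] : NumberField F :=
    { to_finiteDimensional := Module.Finite.trans k F }
  have := numberField M
  have := numberField N
  have := numberField (M ⊔ N)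
  refine of_inertia_eq_bot fun P _ => (Subgroup.eq_bot_iff_forall _).mpr fun j hj => ?_
  have apply_eq {F : IntermediateField k Ω} [NumberField F] [IsGalois k F]
      (hF : IsUnramifiedExtension k F) (hle : F ≤ M ⊔ N) {x : Ω} (hx : x ∈ F) :
      j ⟨x, hle hx⟩ = ⟨x, hle hx⟩ :=
    hF.apply_eq_of_mem_inertia (IntermediateField.inclusion hle : F →+* _)
      (j := j.restrictScalars ℚ) hj j.commutes ⟨x, hx⟩
  have hj1 : (j : ↥(M ⊔ N) →ₐ[k] ↥(M ⊔ N)) = AlgHom.id k _ := by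
    refine IntermediateField.algHom_ext_of_eq_adjoin _ (IntermediateField.sup_def M N) ?_
    rintro x (hx | hx)
    · exact apply_eq hM le_sup_left hx
    · exact apply_eq hN le_sup_right hx
  exact AlgEquiv.ext (AlgHom.congr_fun hj1)

theorem of_normalClosure_eq_top {E : Type*} [Field E] [NumberField E] [Algebra k E]
    [IsGalois k E] [IsGalois ℚ k] [Algebra k L] [IsGalois k L] (hE : IsUnramifiedExtension k E)
    (htop : IntermediateField.normalClosure ℚ E L = ⊤) : IsUnramifiedExtension k L := by
  refine of_inertia_eq_bot fun P _ => (Subgroup.eq_bot_iff_forall _).mpr fun j hj => ?_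
  let D := IntermediateField.fixedField (Subgroup.zpowers (j.restrictScalars ℚ))
  have mem_D {x : L} (hx : j x = x) : x ∈ D := by
    rw [IntermediateField.mem_fixedField_iff]
    exact Subgroup.zpowers_le (H := MulAction.stabilizer Gal(L/ℚ) x).mpr hx
  have hle : IntermediateField.normalClosure ℚ E L ≤ D := by
    refine iSup_le fun f => ?_
    rintro _ ⟨x, rfl⟩
    refine mem_D (hE.apply_eq_of_mem_inertia (f : E →+* L) (j := j.restrictScalars ℚ) hj ?_ x)
    intro a
    -- `f` need not be `k`-linear, but it maps `k` onto itself since `k / ℚ` is normal.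
    have hfa : f (algebraMap k E a) = algebraMap k L _ :=
      (AlgHom.restrictNormal_commutes (f.comp (IsScalarTower.toAlgHom ℚ k E)) k a).symm
    exact (congrArg j hfa).trans ((j.commutes _).trans hfa.symm)
  ext x
  have hx : x ∈ D := hle (htop ▸ IntermediateField.mem_top)
  rw [IntermediateField.mem_fixedField_iff] at hx
  exact hx _ (Subgroup.mem_zpowers _)

theorem exists_isGalois_rat.{u} {E : Type u} [Field E] [NumberField E] [Algebra k E] [IsGalois k E]
    [IsGalois ℚ k] (hE : IsUnramifiedExtension k E) :
    ∃ (L : Type u) (_ : Field L) (_ : NumberField L) (_ : Algebra k L) (_ : E →ₐ[k] L),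
      IsGalois ℚ L ∧ IsUnramifiedExtension k L := by
  let Ω := AlgebraicClosure E
  have : Algebra.IsAlgebraic ℚ Ω := .trans ℚ E Ω
  have : IsAlgClosure ℚ Ω := ⟨inferInstance, inferInstance⟩
  have : Normal ℚ Ω := IsAlgClosure.normal ℚ Ω
  let L := IntermediateField.normalClosure ℚ E Ω
  have : FiniteDimensional ℚ L := normalClosure.is_finiteDimensional ℚ E Ω
  have : NumberField L := { }
  have : Normal ℚ L := normalClosure.normal ℚ E Ω
  let _ : Algebra k L := ((algebraMap E L).comp (algebraMap k E)).toAlgebra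
  have : IsScalarTower k E L := .of_algebraMap_eq fun _ => rfl
  have : IsGalois ℚ L := { }
  have : IsGalois k L := .tower_top_of_isGalois ℚ k L
  have : Nonempty (E →ₐ[ℚ] Ω) := ⟨IsScalarTower.toAlgHom ℚ E Ω⟩
  have htop : IntermediateField.normalClosure ℚ E L = ⊤ :=
    (Algebra.IsAlgebraic.isNormalClosure_iff.mp (isNormalClosure_normalClosure ℚ E Ω)).2
  exact ⟨L, inferInstance, inferInstance, inferInstance, IsScalarTower.toAlgHom k E L,
    inferInstance, hE.of_normalClosure_eq_top htop⟩

end IsUnramifiedExtension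

end Unramified

section Genus

section

variable {G α : Type*} [Group G] [MulAction G α] {T : Set G}

theorem smul_comm_of_closure_eq_top (hT : Subgroup.closure T = ⊤)
    (hcomm : ∀ i ∈ T, ∀ j ∈ T, ∀ x : α, i • j • x = j • i • x) (g h : G) (x : α) :
    g • h • x = h • g • x := by
  have hg : g ∈ Subgroup.closure T := hT ▸ Subgroup.mem_top g
  have hh : h ∈ Subgroup.closure T := hT ▸ Subgroup.mem_top h
  induction hg, hh using Subgroup.closure_induction₂ generalizing x with
  | mem i j hi hj => exact hcomm i hi j hj x
  | one_left | one_right => simp only [one_smul]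
  | mul_left g₁ g₂ h _ _ _ h₁ h₂ => rw [mul_smul, mul_smul, h₂, h₁]
  | mul_right g₁ g₂ h _ _ _ h₁ h₂ => rw [mul_smul, mul_smul, h₁, h₂]
  | inv_left g h _ _ ih => rw [inv_smul_eq_iff, ih, smul_inv_smul]
  | inv_right g h _ _ ih => rw [eq_inv_smul_iff, ← ih, smul_inv_smul]

theorem smul_smul_self_of_closure_eq_top (hT : Subgroup.closure T = ⊤)
    (hcomm : ∀ i ∈ T, ∀ j ∈ T, ∀ x : α, i • j • x = j • i • x)
    (hsq : ∀ i ∈ T, ∀ x : α, i • i • x = x) (g : G) (x : α) : g • g • x = x := by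
  have hg : g ∈ Subgroup.closure T := hT ▸ Subgroup.mem_top g
  induction hg using Subgroup.closure_induction generalizing x with
  | mem i hi => exact hsq i hi x
  | one => rw [one_smul, one_smul]
  | mul g h _ _ hg hh =>
    rw [mul_smul, mul_smul, smul_comm_of_closure_eq_top hT hcomm h g, hg, hh]
  | inv g _ hg => rw [inv_smul_eq_iff, inv_smul_eq_iff, hg]

end

variable {k L : Type*} [Field k] [NumberField k] [Field L] [NumberField L]

theorem isUnramifiedAt_int_under_of_inertia_le [IsGalois ℚ L] {D : Subgroup Gal(L/ℚ)}
    {P : Ideal (𝓞 L)} [P.IsMaximal] (hPD : P.inertia Gal(L/ℚ) ≤ D) :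
    Algebra.IsUnramifiedAt ℤ (P.under (𝓞 (IntermediateField.fixedField D))) := by
  let F := IntermediateField.fixedField D
  let Q := P.under (𝓞 F)
  have : IsGaloisGroup D F L := IsGaloisGroup.subgroup Gal(L/ℚ) ℚ L D
  have : IsGaloisGroup D (𝓞 F) (𝓞 L) := .of_isFractionRing _ _ _ F L
  have hP : P ≠ ⊥ := Ring.ne_bot_of_isMaximal_of_not_isField ‹_›
    (NumberField.RingOfIntegers.not_isField L)
  have hQ : Q ≠ ⊥ := Ideal.IsIntegral.comap_ne_bot (𝓞 F) hP
  have := perfectField_residueField hQ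
  have : PerfectField (Q.under ℤ).ResidueField :=
    perfectField_residueField (Ideal.IsIntegral.comap_ne_bot ℤ hQ)
  have : P.LiesOver (Q.under ℤ) := .trans P Q (Q.under ℤ)
  have hcard : Nat.card (P.inertia D) = Nat.card (P.inertia Gal(L/ℚ)) :=
    Nat.card_congr (Subgroup.subgroupOfEquivOfLe hPD).toEquiv
  have htower := Ideal.ramificationIdx_tower (R := ℤ) Q P
  rw [← Ideal.ramificationIdxIn_eq_ramificationIdx (Q.under ℤ) P Gal(L/ℚ),
    ← Ideal.ramificationIdxIn_eq_ramificationIdx Q P D,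
    ← Ideal.card_inertia_eq_ramificationIdxIn (G := Gal(L/ℚ)) _ P,
    ← Ideal.card_inertia_eq_ramificationIdxIn (G := D) Q P, hcard] at htower
  exact Ideal.ramificationIdx_eq_one_iff.mp ((right_eq_mul₀ Nat.card_pos.ne').mp htower)

theorem closure_inertia_eq_top [IsGalois ℚ L] :
    Subgroup.closure {j : Gal(L/ℚ) | ∃ P : Ideal (𝓞 L), P.IsMaximal ∧ j ∈ P.inertia Gal(L/ℚ)} =
      ⊤ := by
  set D := Subgroup.closure {j : Gal(L/ℚ) | ∃ P : Ideal (𝓞 L), P.IsMaximal ∧ j ∈ P.inertia _}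
  let F := IntermediateField.fixedField D
  have hF : Module.finrank ℚ F = 1 := by
    by_contra h
    obtain ⟨Q, hQ, hram⟩ := NumberField.exists_not_isUnramifiedAt_int (𝒪 := 𝓞 F) h
    obtain ⟨P, hP, hPQ⟩ := Ideal.exists_maximal_ideal_liesOver_of_isIntegral (S := 𝓞 L) Q
    obtain rfl := hPQ.over
    refine hram (isUnramifiedAt_int_under_of_inertia_le fun j hj => ?_)
    exact Subgroup.subset_closure ⟨P, hP, hj⟩
  rw [← IntermediateField.fixingSubgroup_fixedField D,
    show IntermediateField.fixedField D = ⊥ from IntermediateField.finrank_eq_one_iff.mp hF,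
    IntermediateField.fixingSubgroup_bot]

variable [Algebra k L]

namespace IsUnramifiedExtension

theorem mul_self_eq_one_of_mem_inertia [IsGalois k L] (hL : IsUnramifiedExtension k L)
    (hk : Module.finrank ℚ k = 2) {P : Ideal (𝓞 L)} [P.IsMaximal] {i : Gal(L/ℚ)}
    (hi : i ∈ P.inertia Gal(L/ℚ)) : i * i = 1 := by
  have : Algebra.IsQuadraticExtension ℚ k := ⟨hk⟩
  rcases algEquiv_apply_eq_or_of_finrank_eq_two hk i i with h | h | h
  · rw [hL.eq_one_of_mem_inertia hi h, mul_one]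
  · rw [hL.eq_one_of_mem_inertia hi h, mul_one]
  · exact hL.eq_one_of_mem_inertia (mul_mem hi hi) h

theorem inertia_apply_comm [IsGalois k L] (hL : IsUnramifiedExtension k L)
    (hk : Module.finrank ℚ k = 2) {P Q : Ideal (𝓞 L)} [P.IsMaximal] [Q.IsMaximal]
    {i j : Gal(L/ℚ)} (hi : i ∈ P.inertia Gal(L/ℚ)) (hj : j ∈ Q.inertia Gal(L/ℚ)) {x : L}
    (hx : x ^ 2 ∈ Set.range (algebraMap k L)) : i (j x) = j (i x) := by
  have hii := AlgEquiv.congr_fun (hL.mul_self_eq_one_of_mem_inertia hk hi)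
  have hjj := AlgEquiv.congr_fun (hL.mul_self_eq_one_of_mem_inertia hk hj)
  simp only [AlgEquiv.mul_apply, AlgEquiv.one_apply] at hii hjj
  have : Algebra.IsQuadraticExtension ℚ k := ⟨hk⟩
  rcases algEquiv_apply_eq_or_of_finrank_eq_two hk i j with h | h | h
  · rw [hL.eq_one_of_mem_inertia hi h, AlgEquiv.one_apply, AlgEquiv.one_apply]
  · rw [hL.eq_one_of_mem_inertia hj h, AlgEquiv.one_apply, AlgEquiv.one_apply]
  -- The product of the involutions `i` and `j` acts on `x` by a sign; so does its inverse `j * i`.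
  · obtain ⟨a, ha⟩ := hx
    have hsq : i (j x) ^ 2 = x ^ 2 := by rw [← map_pow, ← map_pow, ← ha, h]
    rcases sq_eq_sq_iff_eq_or_eq_neg.mp hsq with hij | hij
    · have hjx : j x = i x := by rw [← hii (j x), hij]
      rw [hij, ← hjx, hjj]
    · have hjx : j x = -i x := by rw [← hii (j x), hij, map_neg]
      rw [hij, ← neg_eq_iff_eq_neg.mpr hjx, map_neg, hjj]

theorem apply_comm_and_apply_apply_eq [IsGalois k L] [IsGalois ℚ L]
    (hL : IsUnramifiedExtension k L) (hk : Module.finrank ℚ k = 2) (σ τ : Gal(L/ℚ)) {x : L}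
    (hx : x ^ 2 ∈ Set.range (algebraMap k L)) : σ (τ x) = τ (σ x) ∧ σ (σ x) = x := by
  have : Algebra.IsQuadraticExtension ℚ k := ⟨hk⟩
  let S : SubMulAction Gal(L/ℚ) L :=
    { carrier := {x | x ^ 2 ∈ Set.range (algebraMap k L)}
      smul_mem' := fun τ x hx => by
        rw [Set.mem_ofPred_eq, AlgEquiv.smul_def, ← map_pow]
        exact algEquiv_apply_mem_range_algebraMap τ hx }
  have hclosure := closure_inertia_eq_top (L := L)
  set T := {j : Gal(L/ℚ) | ∃ P : Ideal (𝓞 L), P.IsMaximal ∧ j ∈ P.inertia Gal(L/ℚ)}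
  have hcomm : ∀ i ∈ T, ∀ j ∈ T, ∀ x : S, i • j • x = j • i • x := by
    rintro i ⟨P, _, hi⟩ j ⟨Q, _, hj⟩ x
    exact Subtype.ext (hL.inertia_apply_comm hk hi hj x.2)
  have hsq : ∀ i ∈ T, ∀ x : S, i • i • x = x := by
    rintro i ⟨P, _, hi⟩ x
    rw [← mul_smul, hL.mul_self_eq_one_of_mem_inertia hk hi, one_smul]
  exact ⟨congrArg Subtype.val (smul_comm_of_closure_eq_top hclosure hcomm σ τ ⟨x, hx⟩),
    congrArg Subtype.val (smul_smul_self_of_closure_eq_top hclosure hcomm hsq σ ⟨x, hx⟩)⟩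

theorem apply_div_mem_range [IsGalois k L] [IsGalois ℚ L]
    (hL : IsUnramifiedExtension k L) (hk : Module.finrank ℚ k = 2) (τ : Gal(L/ℚ)) {u : L}
    (hu : u ^ 2 ∈ Set.range (algebraMap k L)) : τ u / u ∈ Set.range (algebraMap k L) := by
  rw [IsGalois.mem_range_algebraMap_iff_fixed]
  intro g
  have hcomm : g (τ u) = τ (g u) :=
    (hL.apply_comm_and_apply_apply_eq hk (g.restrictScalars ℚ) τ hu).1
  have hg : g u = u ∨ g u = -u := by
    obtain ⟨a, ha⟩ := hu
    rw [← sq_eq_sq_iff_eq_or_eq_neg, ← map_pow, ← ha, g.commutes]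
  rw [map_div₀, hcomm]
  rcases hg with hg | hg <;> rw [hg]
  rw [map_neg, neg_div_neg_eq]

theorem exists_sq_mem_range_rat [IsGalois k L] [IsGalois ℚ L] (hL : IsUnramifiedExtension k L)
    (hk : Module.finrank ℚ k = 2) {u : L} (hu0 : u ≠ 0)
    (hu : u ^ 2 ∈ Set.range (algebraMap k L)) :
    ∃ κ : k, κ ≠ 0 ∧ (κ • u) ^ 2 ∈ Set.range (algebraMap ℚ L) := by
  have : Algebra.IsQuadraticExtension ℚ k := ⟨hk⟩
  obtain ⟨a, ha⟩ := hu
  refine exists_smul_sq_mem_range_algebraMap hu0 fun τ κ => ⟨?_, ?_⟩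
  · obtain ⟨b, hb⟩ := hL.apply_div_mem_range hk τ ⟨a, ha⟩
    obtain ⟨c, hc⟩ := algEquiv_apply_mem_range_algebraMap τ ⟨κ, rfl⟩
    refine ⟨c * b, ?_⟩
    rw [Algebra.smul_def, Algebra.smul_def, map_mul, map_mul, hb, hc, mul_assoc,
      div_mul_cancel₀ _ hu0]
  · refine (hL.apply_comm_and_apply_apply_eq hk τ τ ⟨κ ^ 2 * a, ?_⟩).2
    rw [map_mul, ha, map_pow, Algebra.smul_def, mul_pow]

theorem exists_isQuadraticDiscriminant_eq_mul_sq_of_isGalois [IsGalois k L] [IsGalois ℚ L]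
    (hL : IsUnramifiedExtension k L) (hk : Module.finrank ℚ k = 2) {u : L} (hu0 : u ≠ 0) {a : k}
    (hu : u ^ 2 = algebraMap k L a) :
    ∃ δ : ℤ, IsQuadraticDiscriminant δ ∧ δ ∣ NumberField.discr k ∧
      ∃ c : k, (δ : k) = a * c ^ 2 := by
  obtain ⟨κ, hκ0, r, hr⟩ := hL.exists_sq_mem_range_rat hk hu0 ⟨a, hu.symm⟩
  have hra : (r : k) = κ ^ 2 * a := by
    apply (algebraMap k L).injective
    rw [map_mul, ← hu, map_pow, ← mul_pow, ← Algebra.smul_def, ← hr]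
    simp
  by_cases hθ : κ • u ∈ Set.range (algebraMap ℚ L)
  · obtain ⟨q, hq⟩ := hθ
    obtain ⟨s, hs⟩ := exists_sq_eq_discr hk
    have hrq : r = q ^ 2 := (algebraMap ℚ L).injective (by rw [hr, ← hq, map_pow])
    have hq0 : (q : k) ≠ 0 := by
      rintro h
      rw [Rat.cast_eq_zero.mp h, map_zero, eq_comm, smul_eq_zero] at hq
      exact hq.elim hκ0 hu0
    refine ⟨_, isQuadraticDiscriminant_discr hk, dvd_rfl, s * κ / q, ?_⟩
    rw [hrq, Rat.cast_pow] at hra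
    rw [← hs]
    field_simp
    linear_combination s ^ 2 * hra
  · let F := IntermediateField.adjoin ℚ {κ • u}
    have hF : Module.finrank ℚ F = 2 := finrank_adjoin_simple_eq_two hθ hr.symm
    let θ : F := ⟨κ • u, IntermediateField.mem_adjoin_simple_self ℚ _⟩
    have hθF : θ ∉ Set.range (algebraMap ℚ F) := fun ⟨q, hq⟩ => hθ ⟨q, congrArg Subtype.val hq⟩
    obtain ⟨q, hq⟩ := exists_discr_eq_mul_sq hF hθF (Subtype.ext hr.symm)
    refine ⟨_, isQuadraticDiscriminant_discr hF, hL.discr_dvd_discr (hF.trans hk.symm), κ * q, ?_⟩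
    rw [← Rat.cast_intCast, hq, Rat.cast_mul, Rat.cast_pow, hra]
    ring

theorem exists_isQuadraticDiscriminant_eq_mul_sq [IsGalois k L]
    (hL : IsUnramifiedExtension k L) (hk : Module.finrank ℚ k = 2) {u : L} (hu0 : u ≠ 0) {a : k}
    (hu : u ^ 2 = algebraMap k L a) :
    ∃ δ : ℤ, IsQuadraticDiscriminant δ ∧ δ ∣ NumberField.discr k ∧
      ∃ c : k, (δ : k) = a * c ^ 2 := by
  have : Algebra.IsQuadraticExtension ℚ k := ⟨hk⟩
  obtain ⟨L', _, _, _, f, _, hL'⟩ := hL.exists_isGalois_rat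
  have : IsGalois k L' := .tower_top_of_isGalois ℚ k L'
  refine hL'.exists_isQuadraticDiscriminant_eq_mul_sq_of_isGalois hk
    ((map_ne_zero f).mpr hu0) ?_
  rw [← map_pow, hu, f.commutes]

end IsUnramifiedExtension

end Genus

section AdjoinOver

variable {k Ω : Type*} [Field k] [Field Ω] [Algebra k Ω] {K : IntermediateField k Ω} {r : Ω}

theorem mem_adjoinOver_self : r ∈ adjoinOver K r :=
  IntermediateField.mem_adjoin_simple_self K r

theorem le_adjoinOver : K ≤ adjoinOver K r := fun x hx =>
  IntermediateField.algebraMap_mem (IntermediateField.adjoin K {r}) ⟨x, hx⟩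

theorem adjoinOver_le_iff {N : IntermediateField k Ω} (hKN : K ≤ N) :
    adjoinOver K r ≤ N ↔ r ∈ N := by
  have h : IntermediateField.adjoin K {r} ≤ IntermediateField.extendScalars hKN ↔ r ∈ N :=
    IntermediateField.adjoin_simple_le_iff
  exact h

theorem adjoinOver_eq_self (hr : r ∈ K) : adjoinOver K r = K :=
  le_antisymm ((adjoinOver_le_iff le_rfl).mpr hr) le_adjoinOver

theorem adjoinOver_mul_of_mem {e : Ω} (he : e ∈ K) (he0 : e ≠ 0) :
    adjoinOver K (e * r) = adjoinOver K r := by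
  refine le_antisymm ((adjoinOver_le_iff le_adjoinOver).mpr ?_)
    ((adjoinOver_le_iff le_adjoinOver).mpr ?_)
  · exact mul_mem (le_adjoinOver he) mem_adjoinOver_self
  · have h := mul_mem (le_adjoinOver (inv_mem he)) (mem_adjoinOver_self (K := K) (r := e * r))
    rwa [inv_mul_cancel_left₀ he0] at h

theorem IsH8Extension.finrank_eq_four_of_adjoinOver (hM : IsH8Extension k (adjoinOver K r))
    (hrK : r ∉ K) (hr : r ^ 2 ∈ K) : Module.finrank k K = 4 := by
  have hrK' : r ∉ Set.range (algebraMap K Ω) := fun ⟨x, hx⟩ => hrK (hx ▸ x.2)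
  have h := Module.finrank_mul_finrank k K (IntermediateField.adjoin K {r})
  rw [finrank_adjoin_simple_eq_two (r := ⟨r ^ 2, hr⟩) hrK' rfl,
    show Module.finrank k (IntermediateField.adjoin K {r}) = 8 from hM.finrank_eq] at h
  omega

theorem IsH8Extension.exists_eq_adjoinOver [CharZero k] {N : IntermediateField k Ω}
    (hN : IsH8Extension k N) (hKN : K ≤ N) (hK : Module.finrank k K = 4) :
    ∃ n, n ∉ K ∧ n ^ 2 ∈ K ∧ N = adjoinOver K n := by
  have h := Module.finrank_mul_finrank k K (IntermediateField.extendScalars hKN)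
  rw [hK, show Module.finrank k (IntermediateField.extendScalars hKN) = 8 from hN.finrank_eq] at h
  have h2 : Module.finrank K (IntermediateField.extendScalars hKN) = 2 := by omega
  have : CharZero K := charZero_of_injective_algebraMap (algebraMap k K).injective
  obtain ⟨n, hnK, ⟨ν, hν⟩, hn⟩ := exists_sq_mem_range_adjoin_eq_top h2
  refine ⟨n, fun h => hnK ⟨⟨n, h⟩, rfl⟩, ?_, ?_⟩
  · rw [← IntermediateField.coe_pow, ← hν]
    exact ν.2
  · have := congrArg IntermediateField.lift hn
    rw [IntermediateField.lift_adjoin_simple, IntermediateField.lift_top] at this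
    exact (congrArg (IntermediateField.restrictScalars k) this).symm

end AdjoinOver

theorem exists_isQuadraticDiscriminant_eq_sq {k Ω : Type*} [Field k] [NumberField k] [Field Ω]
    [Algebra k Ω] (hk : Module.finrank ℚ k = 2) {K M N : IntermediateField k Ω}
    (hM : IsH8Extension k M) (hMu : IsUnramifiedExtension k M)
    (hN : IsH8Extension k N) (hNu : IsUnramifiedExtension k N)
    (hKM : K ≤ M) (hKN : K ≤ N) (hK : Module.finrank k K = 4) {m n : Ω}
    (hmM : m ∈ M) (hmK : m ∉ K) (hm : m ^ 2 ∈ K) (hnN : n ∈ N) (hnK : n ∉ K) (hn : n ^ 2 ∈ K) :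
    ∃ δ : ℤ, IsQuadraticDiscriminant δ ∧ δ ∣ NumberField.discr k ∧
      ∃ κ : K, (κ * (m * n)) ^ 2 = (δ : Ω) := by
  have := hM.1
  have := hM.2.1
  have := hN.1
  have := hN.2.1
  have : CharZero Ω := charZero_of_injective_algebraMap (algebraMap k Ω).injective
  have : NumberField ↥(M ⊔ N) := { to_finiteDimensional := Module.Finite.trans k _ }
  obtain ⟨κ, hκ0, a, ha⟩ :=
    exists_sq_mem_range_of_isH8Extension hM hN hKM hKN hK hmM hmK hm hnN hnK hn
  have hm0 : m ≠ 0 := fun h => hmK (h ▸ K.zero_mem)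
  have hn0 : n ≠ 0 := fun h => hnK (h ▸ K.zero_mem)
  have hu0 : κ * (m * n) ≠ 0 :=
    mul_ne_zero (mt (ZeroMemClass.coe_eq_zero).mp hκ0) (mul_ne_zero hm0 hn0)
  let u : ↥(M ⊔ N) := ⟨κ * (m * n), mul_mem (le_sup_left (a := M) (hKM κ.2))
    (mul_mem (le_sup_left (a := M) hmM) (le_sup_right (a := M) hnN))⟩
  obtain ⟨δ, hδ, hδk, c, hc⟩ := (hMu.sup hNu).exists_isQuadraticDiscriminant_eq_mul_sq hk
    (u := u) (fun h => hu0 (congrArg Subtype.val h)) (Subtype.ext ha.symm)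
  refine ⟨δ, hδ, hδk, c • κ, ?_⟩
  rw [IntermediateField.coe_smul, smul_mul_assoc, smul_pow, ← ha, ← map_intCast (algebraMap k Ω),
    hc, map_mul, map_pow, Algebra.smul_def, map_pow, mul_comm]

theorem mainTheorem6_general {k Ω : Type*} [Field k] [NumberField k] [Field Ω] [Algebra k Ω]
    (hk : Module.finrank ℚ k = 2) {K N : IntermediateField k Ω} {μ : K} {m : Ω}
    (hm : m ^ 2 = (μ : Ω))
    (hM : IsH8Extension k (adjoinOver K m)) (hMu : IsUnramifiedExtension k (adjoinOver K m))
    (hN : IsH8Extension k N) (hNu : IsUnramifiedExtension k N) (hKN : K ≤ N) :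
    ∃ δ : ℤ, IsQuadraticDiscriminant δ ∧ δ ∣ NumberField.discr k ∧
      ∃ n : Ω, n ^ 2 = (δ : Ω) * (μ : Ω) ∧ N = adjoinOver K n := by
  by_cases hmK : m ∈ K
  · obtain ⟨s, hs⟩ := exists_sq_eq_discr hk
    have := hN.1
    rw [adjoinOver_eq_self hmK] at hM
    refine ⟨_, isQuadraticDiscriminant_discr hk, dvd_rfl, s • m, ?_, ?_⟩
    · rw [smul_pow, hs, hm, Algebra.smul_def, map_intCast]
    · rw [adjoinOver_eq_self (K.smul_mem hmK)]
      exact (IntermediateField.eq_of_le_of_finrank_eq hKN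
        (hM.finrank_eq.trans hN.finrank_eq.symm)).symm
  have hmK2 : m ^ 2 ∈ K := hm ▸ μ.2
  have hK := hM.finrank_eq_four_of_adjoinOver hmK hmK2
  obtain ⟨n, hnK, hnK2, rfl⟩ := hN.exists_eq_adjoinOver hKN hK
  obtain ⟨δ, hδ, hδk, κ, hsq⟩ := exists_isQuadraticDiscriminant_eq_sq hk hM hMu hN hNu
    le_adjoinOver hKN hK mem_adjoinOver_self hmK hmK2 mem_adjoinOver_self hnK hnK2
  have : CharZero Ω := charZero_of_injective_algebraMap (algebraMap k Ω).injective
  have hδ0 : (δ : Ω) ≠ 0 :=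
    Int.cast_ne_zero.mpr (ne_zero_of_dvd_ne_zero (NumberField.discr_ne_zero k) hδk)
  have hmul : (κ : Ω) * m ^ 2 * (κ * n ^ 2) = δ := by rw [← hsq]; ring
  have hκμ : (κ * μ : Ω) ≠ 0 := hm ▸ left_ne_zero_of_mul (hmul ▸ hδ0)
  refine ⟨δ, hδ, hδk, κ * μ * n, ?_, (adjoinOver_mul_of_mem (mul_mem κ.2 μ.2) hκμ).symm⟩
  rw [← hsq, ← hm]
  ring

theorem mainTheorem6 {k Ω : Type*} [Field k] [NumberField k] [Field Ω] [Algebra k Ω]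
    (hk : Module.finrank ℚ k = 2)
    (d₁ d₂ d₃ : ℤ)
    (hd₁ : IsQuadraticDiscriminant d₁) (hd₂ : IsQuadraticDiscriminant d₂)
    (hd₃ : IsQuadraticDiscriminant d₃)
    (hd : NumberField.discr k = d₁ * d₂ * d₃)
    (s₁ s₂ s₃ : Ω) (hs₁ : s₁ ^ 2 = (d₁ : Ω)) (hs₂ : s₂ ^ 2 = (d₂ : Ω)) (hs₃ : s₃ ^ 2 = (d₃ : Ω))
    (K M N : IntermediateField k Ω)
    (hK : K = IntermediateField.adjoin k {s₁, s₂, s₃})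
    (μ : K) (m : Ω) (hm : m ^ 2 = (μ : Ω))
    (hM : M = adjoinOver K m)
    (hMH : IsH8Extension k M) (hMu : IsUnramifiedExtension k M)
    (hNH : IsH8Extension k N) (hNu : IsUnramifiedExtension k N)
    (hKN : K ≤ N) :
    ∃ δ : ℤ, IsQuadraticDiscriminant δ ∧ δ ∣ NumberField.discr k ∧
      ∃ n : Ω, n ^ 2 = (δ : Ω) * (μ : Ω) ∧ N = adjoinOver K n :=
  mainTheorem6_general hk hm (hM ▸ hMH) (hM ▸ hMu) hNH hNu hKN
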